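/- Let $\mathcal H$ be a real Hilbert space, let $T\colon\mathcal H\to\mathcal H$ be an arbitrary (single-valued, everywhere defined) operator, and set $f\colon\mathcal H\to\mathbb R\colon x\mapsto\tfrac12\|x-Tx\|^2$. For a nonempty closed convex set $C\subseteq\mathcal H$, let $P_C$ denote the projector onto $C$, which sends each $x$ to the unique point of $C$ nearest to $x$, and let $d_C$ be the distance function of $C$. Then the following are equivalent: (i) $T=P_C$ for some nonempty closed convex set $C\subseteq\mathcal H$; (ii) $T$ is monotone, i.e. $\langle x-y,\,Tx-Ty\rangle\ge 0$ for all $x,y\in\mathcal H$, and $f$ is Gâteaux differentiable on $\mathcal H$ with $\nabla f(x)=x-Tx$ for every $x\in\mathcal H$. If (i) or (ii) holds, then the range $\operatorname{ran}T$ is closed and convex, $T=P_{\operatorname{ran}T}$, $f=\tfrac12 d_{\operatorname{ran}T}^2$, and $f$ is Fréchet differentiable on $\mathcal H$. -/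

import Mathlib

open scoped RealInnerProductSpace

/-- In a real Hilbert space every point has a unique best approximation in a nonempty closed convex
set. -/
theorem existsUnique_nearest {H : Type*} [NormedAddCommGroup H] [InnerProductSpace ℝ H]
    [CompleteSpace H] {C : Set H} (hne : C.Nonempty) (hcl : IsClosed C) (hcv : Convex ℝ C) (x : H) :
    ∃! p : H, p ∈ C ∧ ‖x - p‖ = Metric.infDist x C := by
  have key : Metric.infDist x C = ⨅ w : C, ‖x - w‖ := by
    rw [Metric.infDist_eq_iInf]
    simp only [dist_eq_norm]
  obtain ⟨p, hp, hpx⟩ := exists_norm_eq_iInf_of_complete_convex hne hcl.isComplete hcv x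
  refine ⟨p, ⟨hp, by rw [key, hpx]⟩, ?_⟩
  rintro q ⟨hq, hqx⟩
  rw [key] at hqx
  have h1 := (norm_eq_iInf_iff_real_inner_le_zero hcv hp).1 hpx q hq
  have h2 := (norm_eq_iInf_iff_real_inner_le_zero hcv hq).1 hqx p hp
  have h3 : ⟪q - p, q - p⟫ ≤ 0 := by
    have e : ⟪q - p, q - p⟫ = ⟪x - p, q - p⟫ + ⟪x - q, p - q⟫ := by
      simp only [inner_sub_left, inner_sub_right, real_inner_comm]
      ring
    linarith
  exact sub_eq_zero.1 (real_inner_self_nonpos.1 h3)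

/-- The projector `P_C` onto a nonempty closed convex set `C`: it sends `x` to the unique point of
`C` nearest to `x`. -/
noncomputable def projector {H : Type*} [NormedAddCommGroup H] [InnerProductSpace ℝ H]
    [CompleteSpace H] (C : Set H) (hne : C.Nonempty) (hcl : IsClosed C) (hcv : Convex ℝ C) :
    H → H :=
  fun x => (existsUnique_nearest hne hcl hcv x).choose

/-- The set `Proj(H)` of all projectors onto nonempty closed convex subsets of `H`. -/
def projectors (H : Type*) [NormedAddCommGroup H] [InnerProductSpace ℝ H] [CompleteSpace H] :
    Set (H → H) :=
  {T | ∃ (C : Set H) (hne : C.Nonempty) (hcl : IsClosed C) (hcv : Convex ℝ C),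
    T = projector C hne hcl hcv}

/-- A single-valued operator `T` on `H` is monotone if `⟪x - y, T x - T y⟫ ≥ 0` for all `x, y`. -/
def IsMonotoneOperator {H : Type*} [NormedAddCommGroup H] [InnerProductSpace ℝ H]
    (T : H → H) : Prop :=
  ∀ x y : H, 0 ≤ ⟪x - y, T x - T y⟫

/-- `f` is Gâteaux differentiable at `x` with derivative the bounded linear functional `A`. -/
def HasGateauxDerivAt {H : Type*} [NormedAddCommGroup H] [InnerProductSpace ℝ H]
    (f : H → ℝ) (A : H →L[ℝ] ℝ) (x : H) : Prop :=
  ∀ v : H, HasLineDerivAt ℝ f (A v) x v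

/-- `f` is Gâteaux differentiable at `x` with gradient `∇f(x) = g`, the Riesz representative of its
Gâteaux derivative. -/
def HasGateauxGradientAt {H : Type*} [NormedAddCommGroup H] [InnerProductSpace ℝ H]
    (f : H → ℝ) (g x : H) : Prop :=
  HasGateauxDerivAt f (innerSL ℝ g) x

/-! Monotonicity bounds the growth of `f` along a segment by a parabola, giving `f y ≤ ‖y - T x‖² /
2`: so `T y` is nearest to `y` in `ran T`, and `f` is half the squared distance to `ran T`. The hard
point is convexity of `ran T`. Now `g = ‖·‖² / 2 - f` is the supremum of the affine maps `⟪T x, ·⟫ -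
‖T x‖² / 2`, hence convex, with gradient `T`; Tikhonov regularization of `g - ⟪v, ·⟫` shows that
each convex combination `v` of values of `T` lies in the closed set `ran T`. The converse rests on
the variational inequality for projections. -/

theorem infDist_range_eq_of_nearest {E : Type*} [NormedAddCommGroup E] {T : E → E}
    (hnear : ∀ x y, ‖y - T y‖ ≤ ‖y - T x‖) (y : E) :
    ‖y - T y‖ = Metric.infDist y (Set.range T) := by
  apply le_antisymm
  · rw [Metric.le_infDist (Set.range_nonempty T)]
    rintro _ ⟨x, rfl⟩
    simpa [dist_eq_norm] using hnear x y
  · simpa [dist_eq_norm] using Metric.infDist_le_dist_of_mem (x := y) (Set.mem_range_self y)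

theorem isClosed_range_of_nearest {E : Type*} [NormedAddCommGroup E] {T : E → E}
    (hnear : ∀ x y, ‖y - T y‖ ≤ ‖y - T x‖) : IsClosed (Set.range T) := by
  refine isClosed_of_closure_subset fun y hy => ⟨y, ?_⟩
  have h := infDist_range_eq_of_nearest hnear y
  rw [Metric.mem_closure_iff_infDist_zero (Set.range_nonempty T) |>.1 hy, norm_sub_eq_zero_iff] at h
  exact h.symm

section

variable {H : Type*} [NormedAddCommGroup H] [InnerProductSpace ℝ H]

/-- A continuous, uniformly convex (in the midpoint sense) function that is bounded below attains
its minimum. -/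
theorem exists_minimizer_of_midpoint_uniformly_convex [CompleteSpace H] {ψ : H → ℝ}
    (hψ : Continuous ψ) (hb : BddBelow (Set.range ψ)) {c : ℝ} (hc : 0 < c)
    (hmid : ∀ a b, ψ ((1 / 2 : ℝ) • (a + b)) + c * ‖a - b‖ ^ 2 ≤ (ψ a + ψ b) / 2) :
    ∃ p, ∀ y, ψ p ≤ ψ y := by
  set m := ⨅ y, ψ y with hm
  have hmle : ∀ y, m ≤ ψ y := fun y => ciInf_le hb y
  have hex : ∀ n : ℕ, ∃ a, ψ a < m + 1 / ((n : ℝ) + 1) := fun n =>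
    exists_lt_of_ciInf_lt (lt_add_of_pos_right _ (by positivity))
  choose a ha using hex
  have hlim : Filter.Tendsto (fun n : ℕ => 1 / ((n : ℝ) + 1)) Filter.atTop (nhds 0) :=
    tendsto_one_div_add_atTop_nhds_zero_nat
  have hcauchy : CauchySeq a := by
    refine cauchySeq_of_le_tendsto_0 (fun n : ℕ => √(1 / ((n : ℝ) + 1) / c)) ?_ ?_
    · intro i j N hi hj
      rw [dist_eq_norm]
      apply Real.le_sqrt_of_sq_le
      rw [le_div_iff₀ hc]
      have h1 : 1 / ((i : ℝ) + 1) ≤ 1 / ((N : ℝ) + 1) := by gcongr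
      have h2 : 1 / ((j : ℝ) + 1) ≤ 1 / ((N : ℝ) + 1) := by gcongr
      -- The midpoint value is at least `m`, so `c * ‖a i - a j‖ ^ 2` is at most the mean excess
      -- over `m`.
      linarith [hmid (a i) (a j), hmle ((1 / 2 : ℝ) • (a i + a j)), ha i, ha j]
    · simpa using (hlim.div_const c).sqrt
  obtain ⟨p, hp⟩ := cauchySeq_tendsto_of_complete hcauchy
  refine ⟨p, fun y => le_trans ?_ (hmle y)⟩
  refine le_of_tendsto_of_tendsto' ((hψ.tendsto p).comp hp)
    (by simpa using hlim.const_add m) fun n => (ha n).le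

theorem HasGateauxDerivAt.hasDerivAt_line {f : H → ℝ} {A : H →L[ℝ] ℝ} {x w : H} {t : ℝ}
    (h : HasGateauxDerivAt f A (x + t • w)) : HasDerivAt (fun s : ℝ => f (x + s • w)) (A w) t := by
  have h1 : HasDerivAt (fun s : ℝ => f (x + t • w + s • w)) (A w) (t - t) := by
    simpa [HasLineDerivAt] using h w
  have h2 := h1.comp_sub_const t t
  refine h2.congr_of_eventuallyEq (Filter.Eventually.of_forall fun s => ?_)
  change f (x + s • w) = f (x + t • w + (s - t) • w)
  congr 1
  module

variable {T : H → H} {f : H → ℝ}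

/-- If `T` is monotone and `x ↦ x - T x` is the gradient of half the squared residual, then `T y` is
a nearest point of the range of `T` to `y`. -/
theorem norm_sub_le_norm_sub_of_gradient (hf : ∀ x, f x = (1 / 2 : ℝ) * ‖x - T x‖ ^ 2)
    (hmono : IsMonotoneOperator T) (hgrad : ∀ x, HasGateauxGradientAt f (x - T x) x) (x y : H) :
    ‖y - T y‖ ≤ ‖y - T x‖ := by
  set w := y - x with hw
  -- The subtracted parabola makes the derivative `-⟪T (x + t • w) - T x, w⟫`, nonpositive for `t >
  -- 0` by monotonicity.
  have hder : ∀ t : ℝ, HasDerivAt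
      (fun s : ℝ => f (x + s • w) - (1 / 2 * ‖w‖ ^ 2 * s ^ 2 + ⟪x - T x, w⟫ * s))
      (⟪x + t • w - T (x + t • w), w⟫ - (‖w‖ ^ 2 * t + ⟪x - T x, w⟫)) t := by
    intro t
    have h1 := HasGateauxDerivAt.hasDerivAt_line (hgrad (x + t • w))
    have h2 := ((hasDerivAt_pow 2 t).const_mul (1 / 2 * ‖w‖ ^ 2)).add
      ((hasDerivAt_id t).const_mul ⟪x - T x, w⟫)
    refine (h1.sub h2).congr_deriv ?_
    simp only [innerSL_apply_apply]
    ring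
  have hcont : ContinuousOn
      (fun s : ℝ => f (x + s • w) - (1 / 2 * ‖w‖ ^ 2 * s ^ 2 + ⟪x - T x, w⟫ * s))
      (Set.Icc 0 1) := fun t _ => (hder t).continuousAt.continuousWithinAt
  obtain ⟨t, ht, heq⟩ := exists_hasDerivAt_eq_slope _ _ zero_lt_one hcont fun t _ => hder t
  have hm := hmono (x + t • w) x
  rw [add_sub_cancel_left, inner_smul_left, real_inner_comm] at hm
  have hm' : 0 ≤ ⟪T (x + t • w) - T x, w⟫ := nonneg_of_mul_nonneg_right (by simpa using hm) ht.1
  have hy : x + w = y := by simp [hw]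
  simp only [one_smul, zero_smul, add_zero, hy, sub_zero, one_pow, mul_one, div_one,
    mul_zero, ne_eq, OfNat.ofNat_ne_zero, not_false_eq_true, zero_pow, hf] at heq
  simp only [inner_sub_left, inner_add_left, inner_smul_left, real_inner_self_eq_norm_sq,
    conj_trivial] at heq hm'
  have hexp : ‖y - T x‖ ^ 2 = ‖x - T x‖ ^ 2 + 2 * (⟪x, w⟫ - ⟪T x, w⟫) + ‖w‖ ^ 2 := by
    rw [← inner_sub_left, ← norm_add_sq_real, ← hy]
    congr 2
    abel
  refine le_of_sq_le_sq ?_ (norm_nonneg _)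
  linarith

/-- A point `p` minimizing `y ↦ ‖y‖² / 2 - f y - ⟪v, y⟫ + ε ‖y‖² / 2` satisfies `T p + ε p = v`. -/
theorem add_smul_eq_of_minimizer (hgrad : ∀ x, HasGateauxGradientAt f (x - T x) x) {ε : ℝ} {v p : H}
    (hp : ∀ y, (1 + ε) / 2 * ‖p‖ ^ 2 - f p - ⟪v, p⟫ ≤ (1 + ε) / 2 * ‖y‖ ^ 2 - f y - ⟪v, y⟫) :
    T p + ε • p = v := by
  -- This is the gradient at `p`; testing stationarity along it yields `⟪w, w⟫ = 0`.
  set w := T p + ε • p - v with hw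
  have h1 : HasDerivAt (fun s : ℝ => f (p + s • w)) ⟪p - T p, w⟫ 0 := hgrad p w
  have h2 : HasDerivAt (fun s : ℝ => (1 + ε) / 2 * (‖p‖ ^ 2 + 2 * ⟪p, w⟫ * s + ‖w‖ ^ 2 * s ^ 2)
      - f (p + s • w) - (⟪v, p⟫ + ⟪v, w⟫ * s))
      ((1 + ε) * ⟪p, w⟫ - ⟪p - T p, w⟫ - ⟪v, w⟫) 0 := by
    have ha := ((((hasDerivAt_id (0 : ℝ)).const_mul (2 * ⟪p, w⟫)).const_add (‖p‖ ^ 2)).add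
      ((hasDerivAt_pow 2 (0 : ℝ)).const_mul (‖w‖ ^ 2))).const_mul ((1 + ε) / 2)
    have hb := ((hasDerivAt_id (0 : ℝ)).const_mul ⟪v, w⟫).const_add ⟪v, p⟫
    refine (((ha.sub h1).sub hb).congr_of_eventuallyEq
      (Filter.Eventually.of_forall fun s => by simp)).congr_deriv ?_
    norm_num
    ring
  have hmin : IsLocalMin (fun s : ℝ => (1 + ε) / 2 * (‖p‖ ^ 2 + 2 * ⟪p, w⟫ * s + ‖w‖ ^ 2 * s ^ 2)
      - f (p + s • w) - (⟪v, p⟫ + ⟪v, w⟫ * s)) 0 := by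
    refine Filter.Eventually.of_forall fun s => ?_
    have h := hp (p + s • w)
    rw [norm_add_sq_real, inner_add_right, inner_smul_right, inner_smul_right, norm_smul, mul_pow,
      Real.norm_eq_abs, sq_abs] at h
    simp only [zero_smul, add_zero, mul_zero, ne_eq, OfNat.ofNat_ne_zero, not_false_eq_true,
      zero_pow]
    linarith
  have h0 := hmin.hasDerivAt_eq_zero h2
  have hww : ⟪w, w⟫ = 0 := by
    conv_lhs => enter [2]; rw [hw]
    rw [← h0]
    simp only [inner_sub_left, inner_add_left, inner_smul_left, conj_trivial]
    ring
  exact sub_eq_zero.1 (inner_self_eq_zero.1 hww)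

/-- Adding `ε ‖·‖² / 2` to `g - ⟪v, ·⟫`, which is bounded below, gives a minimizer `p` with `v - T p
= ε • p`, of norm `O(√ε)`. -/
theorem convex_range_of_gradient [CompleteSpace H] (hf : ∀ x, f x = (1 / 2 : ℝ) * ‖x - T x‖ ^ 2)
    (hgrad : ∀ x, HasGateauxGradientAt f (x - T x) x)
    (hnear : ∀ x y, ‖y - T y‖ ≤ ‖y - T x‖) : Convex ℝ (Set.range T) := by
  have hfle : ∀ x y, f y ≤ 1 / 2 * ‖y‖ ^ 2 - ⟪T x, y⟫ + 1 / 2 * ‖T x‖ ^ 2 := fun x y => by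
    have h := pow_le_pow_left₀ (norm_nonneg _) (hnear x y) 2
    rw [norm_sub_sq_real y (T x), real_inner_comm] at h
    rw [hf]
    linarith
  have hfeq : ∀ y, f y = 1 / 2 * ‖y‖ ^ 2 - ⟪T y, y⟫ + 1 / 2 * ‖T y‖ ^ 2 := fun y => by
    rw [hf, norm_sub_sq_real, real_inner_comm]
    ring
  have hfc : Continuous f := by
    have : f = fun y => (1 / 2 : ℝ) * Metric.infDist y (Set.range T) ^ 2 := by
      funext y
      rw [hf, infDist_range_eq_of_nearest hnear]
    rw [this]
    exact continuous_const.mul ((Metric.continuous_infDist_pt _).pow 2)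
  rintro _ ⟨x₁, rfl⟩ _ ⟨x₂, rfl⟩ α β hα hβ hαβ
  set v := α • T x₁ + β • T x₂ with hv
  rw [← (isClosed_range_of_nearest hnear).closure_eq]
  set K := α * (1 / 2 * ‖T x₁‖ ^ 2) + β * (1 / 2 * ‖T x₂‖ ^ 2) with hK
  have hlow : ∀ y, -K ≤ 1 / 2 * ‖y‖ ^ 2 - f y - ⟪v, y⟫ := fun y => by
    have h1 := mul_le_mul_of_nonneg_left (hfle x₁ y) hα
    have h2 := mul_le_mul_of_nonneg_left (hfle x₂ y) hβ
    have h3 : f y = α * f y + β * f y := by rw [← add_mul, hαβ, one_mul]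
    have h4 : ‖y‖ ^ 2 = α * ‖y‖ ^ 2 + β * ‖y‖ ^ 2 := by rw [← add_mul, hαβ, one_mul]
    rw [hv, inner_add_left, inner_smul_left, inner_smul_left, conj_trivial, conj_trivial]
    linarith
  have hsol : ∀ ε : ℝ, 0 < ε → ∃ p, T p + ε • p = v ∧ ε / 2 * ‖p‖ ^ 2 ≤ K - f 0 := by
    intro ε hε
    -- The affine minorant of `g` with slope `T m` is exact at the midpoint `m`; the parallelogram
    -- law supplies `ε / 8`.
    have hmid : ∀ a b, (1 + ε) / 2 * ‖(1 / 2 : ℝ) • (a + b)‖ ^ 2 - f ((1 / 2 : ℝ) • (a + b))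
        - ⟪v, (1 / 2 : ℝ) • (a + b)⟫ + ε / 8 * ‖a - b‖ ^ 2 ≤ ((1 + ε) / 2 * ‖a‖ ^ 2 - f a - ⟪v, a⟫
        + ((1 + ε) / 2 * ‖b‖ ^ 2 - f b - ⟪v, b⟫)) / 2 := by
      intro a b
      set m := (1 / 2 : ℝ) • (a + b) with hm
      have ha := hfle m a
      have hb := hfle m b
      have hmm := hfeq m
      have e1 : ⟪T m, m⟫ = (⟪T m, a⟫ + ⟪T m, b⟫) / 2 := by
        conv_lhs => enter [2]; rw [hm]
        rw [inner_smul_right, inner_add_right]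
        ring
      have e2 : ⟪v, m⟫ = (⟪v, a⟫ + ⟪v, b⟫) / 2 := by
        rw [hm, inner_smul_right, inner_add_right]
        ring
      have e3 : ‖m‖ ^ 2 = (‖a‖ ^ 2 + ‖b‖ ^ 2) / 2 - ‖a - b‖ ^ 2 / 4 := by
        rw [hm, norm_smul, mul_pow, norm_add_sq_real, norm_sub_sq_real]
        norm_num
        ring
      rw [e2, hmm, e1, e3]
      linarith
    obtain ⟨p, hp⟩ := exists_minimizer_of_midpoint_uniformly_convex
      (ψ := fun y => (1 + ε) / 2 * ‖y‖ ^ 2 - f y - ⟪v, y⟫) (c := ε / 8)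
      (by fun_prop)
      ⟨-K, by
        rintro _ ⟨y, rfl⟩
        have : 0 ≤ ε / 2 * ‖y‖ ^ 2 := by positivity
        linarith [hlow y]⟩ (by positivity) hmid
    refine ⟨p, add_smul_eq_of_minimizer hgrad hp, ?_⟩
    have h0 := hp 0
    simp only [norm_zero, inner_zero_right, ne_eq, OfNat.ofNat_ne_zero, not_false_eq_true,
      zero_pow] at h0
    linarith [hlow p]
  have hK0 : 0 ≤ K - f 0 := by
    obtain ⟨p, -, hp⟩ := hsol 1 one_pos
    exact le_trans (by positivity) hp
  rw [Metric.mem_closure_iff]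
  intro δ hδ
  -- Chosen so that `2 * ε * (K - f 0) < δ ^ 2`; the `+ 1` keeps the denominator positive.
  set ε := δ ^ 2 / (2 * (K - f 0) + 1) / 2 with hε
  have hε0 : 0 < ε := by positivity
  obtain ⟨p, hpv, hp⟩ := hsol ε hε0
  refine ⟨T p, Set.mem_range_self p, ?_⟩
  rw [dist_eq_norm, ← hpv, add_sub_cancel_left, norm_smul, Real.norm_of_nonneg hε0.le]
  refine lt_of_pow_lt_pow_left₀ 2 hδ.le ?_
  have h1 : (ε * ‖p‖) ^ 2 ≤ 2 * ε * (K - f 0) := by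
    have := mul_le_mul_of_nonneg_left hp (by positivity : 0 ≤ 2 * ε)
    linarith
  have h2 : ε * (2 * (K - f 0) + 1) * 2 = δ ^ 2 := by
    rw [hε]
    field_simp
  nlinarith [sq_pos_of_pos hδ]

variable [CompleteSpace H] {C : Set H} (hne : C.Nonempty) (hcl : IsClosed C) (hcv : Convex ℝ C)

theorem projector_mem (x : H) : projector C hne hcl hcv x ∈ C :=
  (existsUnique_nearest hne hcl hcv x).choose_spec.1.1

theorem norm_sub_projector (x : H) : ‖x - projector C hne hcl hcv x‖ = Metric.infDist x C :=
  (existsUnique_nearest hne hcl hcv x).choose_spec.1.2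

theorem inner_sub_projector_nonpos (x : H) {c : H} (hc : c ∈ C) :
    ⟪x - projector C hne hcl hcv x, c - projector C hne hcl hcv x⟫ ≤ 0 := by
  refine (norm_eq_iInf_iff_real_inner_le_zero hcv (projector_mem hne hcl hcv x)).1 ?_ c hc
  rw [norm_sub_projector, Metric.infDist_eq_iInf]
  simp only [dist_eq_norm]

theorem isMonotoneOperator_projector : IsMonotoneOperator (projector C hne hcl hcv) := by
  intro x y
  have h1 := inner_sub_projector_nonpos hne hcl hcv x (projector_mem hne hcl hcv y)
  have h2 := inner_sub_projector_nonpos hne hcl hcv y (projector_mem hne hcl hcv x)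
  set p := projector C hne hcl hcv x
  set q := projector C hne hcl hcv y
  have h3 : ⟪x - y, p - q⟫ = ⟪p - q, p - q⟫ - ⟪x - p, q - p⟫ - ⟪y - q, p - q⟫ := by
    simp only [inner_sub_left, inner_sub_right]
    ring
  linarith [real_inner_self_nonneg (x := p - q)]

/-- The first-order remainder lies in `[0, ‖y - x‖² / 2]`: above by comparing `y` with the
projection of `x`, below by the variational inequality at `x`. -/
theorem hasFDerivAt_half_sq_norm_sub_projector (x : H) :
    HasFDerivAt (fun y => (1 / 2 : ℝ) * ‖y - projector C hne hcl hcv y‖ ^ 2)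
      (innerSL ℝ (x - projector C hne hcl hcv x)) x := by
  refine HasFDerivAt.of_isLittleO ?_
  refine Asymptotics.IsBigO.trans_isLittleO (g := fun y => ‖y - x‖ ^ 2) ?_ ?_
  · refine Asymptotics.IsBigO.of_bound 1 (Filter.Eventually.of_forall fun y => ?_)
    have h1 := inner_sub_projector_nonpos hne hcl hcv x (projector_mem hne hcl hcv y)
    have h2 : ‖y - projector C hne hcl hcv y‖ ≤ ‖y - projector C hne hcl hcv x‖ := by
      rw [norm_sub_projector, ← dist_eq_norm]
      exact Metric.infDist_le_dist_of_mem (projector_mem hne hcl hcv x)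
    have h2' := pow_le_pow_left₀ (norm_nonneg _) h2 2
    set p := projector C hne hcl hcv x
    set q := projector C hne hcl hcv y
    have e1 : ‖y - p‖ ^ 2 = ‖x - p‖ ^ 2 + 2 * ⟪x - p, y - x⟫ + ‖y - x‖ ^ 2 := by
      rw [← norm_add_sq_real]
      congr 2
      abel
    have e2 : ‖y - q‖ ^ 2 = ‖x - p‖ ^ 2 + 2 * (⟪x - p, y - x⟫ - ⟪x - p, q - p⟫)
        + ‖(y - x) - (q - p)‖ ^ 2 := by
      rw [← inner_sub_right, ← norm_add_sq_real]
      congr 2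
      abel
    rw [innerSL_apply_apply, one_mul, norm_pow, norm_norm, Real.norm_eq_abs, abs_le]
    constructor
    · linarith [sq_nonneg ‖(y - x) - (q - p)‖, sq_nonneg ‖y - x‖]
    · linarith [sq_nonneg ‖y - x‖]
  · exact Asymptotics.isLittleO_pow_sub_sub x one_lt_two

end

theorem theoremt {H : Type*} [NormedAddCommGroup H] [InnerProductSpace ℝ H] [CompleteSpace H]
    (T : H → H) (f : H → ℝ) (hf : ∀ x, f x = (1 / 2 : ℝ) * ‖x - T x‖ ^ 2) :
    (T ∈ projectors H ↔
      IsMonotoneOperator T ∧ ∀ x, HasGateauxGradientAt f (x - T x) x) ∧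
    ((T ∈ projectors H ∨
        (IsMonotoneOperator T ∧ ∀ x, HasGateauxGradientAt f (x - T x) x)) →
      (∃ (hcl : IsClosed (Set.range T)) (hcv : Convex ℝ (Set.range T)),
        T = projector (Set.range T) (Set.range_nonempty T) hcl hcv) ∧
      (∀ x, f x = (1 / 2 : ℝ) * Metric.infDist x (Set.range T) ^ 2) ∧
      Differentiable ℝ f) := by
  have hfd : T ∈ projectors H → ∀ x, HasFDerivAt f (innerSL ℝ (x - T x)) x := by
    rintro ⟨C, hne, hcl, hcv, rfl⟩ x
    rw [funext hf]
    exact hasFDerivAt_half_sq_norm_sub_projector hne hcl hcv x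
  have hforward : T ∈ projectors H →
      IsMonotoneOperator T ∧ ∀ x, HasGateauxGradientAt f (x - T x) x := by
    intro hT
    refine ⟨?_, fun x v => (hfd hT x).hasLineDerivAt v⟩
    obtain ⟨C, hne, hcl, hcv, rfl⟩ := hT
    exact isMonotoneOperator_projector hne hcl hcv
  have hproj : (IsMonotoneOperator T ∧ ∀ x, HasGateauxGradientAt f (x - T x) x) →
      (∃ (hcl : IsClosed (Set.range T)) (hcv : Convex ℝ (Set.range T)),
        T = projector (Set.range T) (Set.range_nonempty T) hcl hcv) ∧
      (∀ x, f x = (1 / 2 : ℝ) * Metric.infDist x (Set.range T) ^ 2) := by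
    rintro ⟨hmono, hgrad⟩
    have hnear := norm_sub_le_norm_sub_of_gradient hf hmono hgrad
    have hcl := isClosed_range_of_nearest hnear
    have hcv := convex_range_of_gradient hf hgrad hnear
    refine ⟨⟨hcl, hcv, funext fun x => ?_⟩, fun x => ?_⟩
    · exact (existsUnique_nearest (Set.range_nonempty T) hcl hcv x).unique
        ⟨Set.mem_range_self x, infDist_range_eq_of_nearest hnear x⟩
        ⟨projector_mem _ hcl hcv x, norm_sub_projector _ hcl hcv x⟩
    · rw [hf, infDist_range_eq_of_nearest hnear]
  have hback : (IsMonotoneOperator T ∧ ∀ x, HasGateauxGradientAt f (x - T x) x) →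
      T ∈ projectors H := by
    intro h
    obtain ⟨⟨hcl, hcv, hT⟩, -⟩ := hproj h
    exact ⟨_, Set.range_nonempty T, hcl, hcv, hT⟩
  refine ⟨⟨hforward, hback⟩, fun h => ?_⟩
  have hii := h.elim hforward id
  obtain ⟨hrange, hdist⟩ := hproj hii
  exact ⟨hrange, hdist, fun x => (hfd (hback hii) x).differentiableAt⟩
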